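/- Let $E$ be a finite set, let $f\in E$, and let $\mathcal M$ be an oriented matroid on the ground set $E$. Let $V=\{x_i : i\in E\setminus\{f\}\}\cup\{y_i : i\in E\setminus\{f\}\}$ be a set of $2(|E|-1)$ vertices. For any oriented matroid $\mathcal N$ on $E$, let $\Delta(\mathcal N,f)$ be the simplicial complex on $V$ whose facets are the complements in $V$ of the sets $$\{x_i : i\in C^+,\ i\ne f\}\ \cup\ \{y_j : j\in C^-\},$$ where $C=(C^+,C^-)$ runs over all signed cocircuits of $\mathcal N$ with $f\in C^+$ (if there is no such $C$, then $\Delta(\mathcal N,f)$ is the complex with no faces at all). For a simplicial complex $K$ on $V$, its Alexander dual is $K^\vee=\{V\setminus\sigma : \sigma\subseteq V,\ \sigma\notin K\}$. Let $\mathcal M^*$ be the oriented matroid dual to $\mathcal M$, and let ${}_{-f}\mathcal M^*$ be obtained from $\mathcal M^*$ by reorienting the element $f$. Then $$\Delta(\mathcal M,f)^\vee \;=\; \Delta({}_{-f}\mathcal M^*,f).$$ In particular, this holds for every affine oriented matroid $(\mathcal M,f)$. -/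

import Mathlib

/-- A signed subset `X = (X⁺, X⁻)` of `E`, given by its sign vector:
`X⁺` is the set where the value is `1` and `X⁻` the set where it is `-1`. -/
abbrev SignedSet (E : Type*) := E → SignType

namespace SignedSet

variable {E : Type*}

/-- The positive part `X⁺`. -/
def pos (X : SignedSet E) : Set E := {e | X e = 1}

/-- The negative part `X⁻`. -/
def neg (X : SignedSet E) : Set E := {e | X e = -1}

/-- The support `X⁺ ∪ X⁻`. -/
def supp (X : SignedSet E) : Set E := {e | X e ≠ 0}

/-- Orthogonality of signed sets: either the supports are disjoint, or there are two common
elements such that the signs agree at one of them and are opposite at the other. -/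
def Orth (X Y : SignedSet E) : Prop :=
  (∀ e, X e * Y e = 0) ∨ ((∃ e, X e * Y e = 1) ∧ ∃ g, X g * Y g = -1)

open Classical in
/-- Reversing the sign of the element `f`. -/
noncomputable def reorient (f : E) (X : SignedSet E) : SignedSet E :=
  fun e => if e = f then -X e else X e

end SignedSet

/-- An oriented matroid on the ground set `E`, given by its signed circuits. -/
@[ext]
structure OrientedMatroid (E : Type*) where
  /-- The signed circuits. -/
  circuits : Set (SignedSet E)
  zero_notMem : (0 : SignedSet E) ∉ circuits
  neg_mem : ∀ X ∈ circuits, -X ∈ circuits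
  incomparable : ∀ X ∈ circuits, ∀ Y ∈ circuits, X.supp ⊆ Y.supp → X = Y ∨ X = -Y
  elimination : ∀ X ∈ circuits, ∀ Y ∈ circuits, X ≠ -Y → ∀ e, e ∈ X.pos → e ∈ Y.neg →
    ∃ Z ∈ circuits, Z.pos ⊆ (X.pos ∪ Y.pos) \ {e} ∧ Z.neg ⊆ (X.neg ∪ Y.neg) \ {e}

namespace OrientedMatroid

variable {E : Type*}

/-- The signed cocircuits: the nonzero signed sets orthogonal to all circuits whose support is
inclusion-minimal. -/
def cocircuits (M : OrientedMatroid E) : Set (SignedSet E) :=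
  {Y | Y ≠ 0 ∧ (∀ X ∈ M.circuits, X.Orth Y) ∧
    ∀ Y' : SignedSet E, Y' ≠ 0 → (∀ X ∈ M.circuits, X.Orth Y') → Y'.supp ⊆ Y.supp →
      Y'.supp = Y.supp}

end OrientedMatroid

/-- An abstract simplicial complex on the (finite) vertex set `V`: a family of subsets of `V`
closed under taking subsets. The complex without faces, different from the complex whose
only face is `∅`, is included, and elements of `V` need not be faces. -/
@[ext]
structure AbstractComplex (V : Type*) where
  /-- The faces. -/
  faces : Set (Set V)
  down_closed : ∀ σ ∈ faces, ∀ τ ⊆ σ, τ ∈ faces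

namespace AbstractComplex

variable {V : Type*}

/-- The facets: the inclusion-maximal faces. -/
def facets (K : AbstractComplex V) : Set (Set V) := {σ | Maximal (· ∈ K.faces) σ}

/-- The Alexander dual `{V \ σ : σ ∉ K}`. -/
def alexanderDual (K : AbstractComplex V) : AbstractComplex V where
  faces := {τ | ∃ σ, σ ∉ K.faces ∧ τ = σᶜ}
  down_closed := by
    rintro _ ⟨σ, hσ, rfl⟩ τ hτ
    exact ⟨τᶜ, fun h => hσ (K.down_closed _ h _ (Set.subset_compl_comm.1 hτ)), by simp⟩

end AbstractComplex

namespace OrientedMatroid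

variable {E : Type*}

/-- The vertex set `{x_i : i ≠ f} ∪ {y_i : i ≠ f}`: `Sum.inl i` is `x_i`, `Sum.inr i` is `y_i`. -/
abbrev Vertex (f : E) := {i : E // i ≠ f} ⊕ {i : E // i ≠ f}

/-- The vertices `{x_i : i ∈ C⁺} ∪ {y_j : j ∈ C⁻}` of a signed set `C`, where `i, j ≠ f`. -/
def vertexSet (f : E) (C : SignedSet E) : Set (Vertex f) :=
  {v | (∃ i : {i : E // i ≠ f}, v = Sum.inl i ∧ i.1 ∈ C.pos) ∨
    ∃ j : {i : E // i ≠ f}, v = Sum.inr j ∧ j.1 ∈ C.neg}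

/-- The complex `Δ(M, f)` generated by the complements of the sets
`{x_i : i ∈ C⁺} ∪ {y_j : j ∈ C⁻}`, for all signed cocircuits `C` with `f ∈ C⁺`. -/
def affineComplex (M : OrientedMatroid E) (f : E) : AbstractComplex (Vertex f) where
  faces := {σ | ∃ C ∈ M.cocircuits, f ∈ C.pos ∧ σ ⊆ (vertexSet f C)ᶜ}
  down_closed := by
    rintro σ ⟨C, hC, hf, hσ⟩ τ hτ
    exact ⟨C, hC, hf, hτ.trans hσ⟩

/-- The facets of `Δ(M, f)` are exactly the complements that generate it. -/
theorem facets_affineComplex (M : OrientedMatroid E) (f : E) :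
    (M.affineComplex f).facets =
      {σ | ∃ C ∈ M.cocircuits, f ∈ C.pos ∧ σ = (vertexSet f C)ᶜ} := by
  ext σ
  constructor
  · rintro ⟨⟨C, hC, hf, hσ⟩, hmax⟩
    exact ⟨C, hC, hf, Set.Subset.antisymm hσ (hmax ⟨C, hC, hf, Set.Subset.rfl⟩ hσ)⟩
  · rintro ⟨C, hC, hf, rfl⟩
    refine ⟨⟨C, hC, hf, Set.Subset.rfl⟩, ?_⟩
    rintro τ ⟨C', hC', hf', hτ⟩ hle
    refine hτ.trans (Set.compl_subset_compl.2 ?_)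
    have hsub : vertexSet f C' ⊆ vertexSet f C := Set.compl_subset_compl.1 (hle.trans hτ)
    have hp : ∀ i, C' i = 1 → C i = 1 := by
      intro i hi
      by_cases hif : i = f
      · rw [hif]; exact hf
      · rcases hsub (show (Sum.inl ⟨i, hif⟩ : Vertex f) ∈ _ from Or.inl ⟨_, rfl, hi⟩) with
          ⟨k, hk, h⟩ | ⟨k, hk, h⟩
        · rw [← Sum.inl.inj hk] at h; exact h
        · cases hk
    have hn : ∀ i, C' i = -1 → C i = -1 := by
      intro i hi
      by_cases hif : i = f
      · have hf' : C' f = 1 := hf'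
        rw [hif, hf'] at hi; exact absurd hi (by decide)
      · rcases hsub (show (Sum.inr ⟨i, hif⟩ : Vertex f) ∈ _ from Or.inr ⟨_, rfl, hi⟩) with
          ⟨k, hk, h⟩ | ⟨k, hk, h⟩
        · cases hk
        · rw [← Sum.inr.inj hk] at h; exact h
    have hs : C'.supp = C.supp := hC.2.2 C' hC'.1 hC'.2.1 (by
      intro i hi
      rcases SignType.trichotomy (C' i) with h | h | h
      · exact fun h' => by rw [hn i h] at h'; exact absurd h' (by decide)
      · exact absurd h hi
      · exact fun h' => by rw [hp i h] at h'; exact absurd h' (by decide))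
    have heq : C' = C := by
      funext i
      rcases SignType.trichotomy (C' i) with h | h | h
      · rw [h, hn i h]
      · have : i ∉ C.supp := by rw [← hs]; exact fun h' => h' h
        have : C i = 0 := by simpa [SignedSet.supp] using this
        rw [h, this]
      · rw [h, hp i h]
    rw [heq]

end OrientedMatroid

namespace OrientedMatroid

variable {E : Type*}

/- The following facts show that the cocircuits are the circuits of an oriented matroid, the dual
of `M`. -/

theorem eq_or_eq_neg_sign (a b : SignType) (ha : a ≠ 0) (hb : b ≠ 0) : a = b ∨ a = -b := by
  revert a b; decide

/-- Symmetric form of weak elimination. -/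
theorem elim (M : OrientedMatroid E) {X Y : SignedSet E} (hX : X ∈ M.circuits)
    (hY : Y ∈ M.circuits) (hne : X ≠ -Y) {e : E} (he : X e = -Y e) (h0 : X e ≠ 0) :
    ∃ Z ∈ M.circuits, Z e = 0 ∧ ∀ g, Z g = 0 ∨ Z g = X g ∨ Z g = Y g := by
  have key : ∀ X ∈ M.circuits, ∀ Y ∈ M.circuits, X ≠ -Y → X e = 1 → Y e = -1 →
      ∃ Z ∈ M.circuits, Z e = 0 ∧ ∀ g, Z g = 0 ∨ Z g = X g ∨ Z g = Y g := by
    intro X hX Y hY hne h1 h2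
    obtain ⟨Z, hZ, hp, hn⟩ := M.elimination X hX Y hY hne e h1 h2
    have H : ∀ g, Z g = 0 ∨ (g ≠ e ∧ (Z g = X g ∨ Z g = Y g)) := by
      intro g
      rcases h : Z g with _ | _ | _
      · exact Or.inl rfl
      · have := hn (show g ∈ Z.neg from h)
        obtain ⟨h3 | h3, h4⟩ := this
        · exact Or.inr ⟨h4, Or.inl h3.symm⟩
        · exact Or.inr ⟨h4, Or.inr h3.symm⟩
      · have := hp (show g ∈ Z.pos from h)
        obtain ⟨h3 | h3, h4⟩ := this
        · exact Or.inr ⟨h4, Or.inl h3.symm⟩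
        · exact Or.inr ⟨h4, Or.inr h3.symm⟩
    refine ⟨Z, hZ, ?_, fun g => ?_⟩
    · rcases H e with h | h
      · exact h
      · exact absurd rfl h.1
    · rcases H g with h | h
      · exact Or.inl h
      · exact Or.inr h.2
  rcases hs : X e with _ | _ | _
  · exact absurd hs h0
  · obtain ⟨Z, h1, h2, h3⟩ := key Y hY X hX (by rintro rfl; simp at hne)
      (by rw [hs] at he; revert he; generalize Y e = y; revert y; decide) hs
    exact ⟨Z, h1, h2, fun g => by have := h3 g; tauto⟩
  · exact key X hX Y hY hne hs (by rw [hs] at he; revert he; generalize Y e = y; revert y; decide)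

/-- Elimination for supports. -/
theorem elim_supp (M : OrientedMatroid E) {X Y : SignedSet E} (hX : X ∈ M.circuits)
    (hY : Y ∈ M.circuits) {e f : E} (hXe : X e ≠ 0) (hYe : Y e ≠ 0) (hXf : X f ≠ 0)
    (hYf : Y f = 0) :
    ∃ Z ∈ M.circuits, Z e = 0 ∧ ∀ g, Z g ≠ 0 → X g ≠ 0 ∨ Y g ≠ 0 := by
  rcases eq_or_eq_neg_sign _ _ hXe hYe with h | h
  · obtain ⟨Z, h1, h2, h3⟩ := M.elim hX (M.neg_mem _ hY) (e := e)
      (by rintro rfl; simp [hYf] at hXf) (by simpa using h) hXe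
    refine ⟨Z, h1, h2, fun g hg => ?_⟩
    rcases h3 g with h | h | h
    · exact absurd h hg
    · left; rwa [← h]
    · right; intro h'; simp [h'] at h; exact hg h
  · obtain ⟨Z, h1, h2, h3⟩ := M.elim hX hY (e := e)
      (by rintro rfl; simp [hYf] at hXf) h hXe
    refine ⟨Z, h1, h2, fun g hg => ?_⟩
    rcases h3 g with h | h | h
    · exact absurd h hg
    · left; rwa [← h]
    · right; rwa [← h]

/-- A circuit whose support lies in that of another one has the same support. -/
theorem supp_eq (M : OrientedMatroid E) {X Y : SignedSet E} (hX : X ∈ M.circuits)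
    (hY : Y ∈ M.circuits) (h : ∀ g, X g ≠ 0 → Y g ≠ 0) (g : E) : Y g ≠ 0 → X g ≠ 0 := by
  rcases M.incomparable X hX Y hY h with rfl | rfl
  · exact id
  · simp

/-- Strong elimination for supports. -/
theorem strong_supp [Finite E] (M : OrientedMatroid E) {X Y : SignedSet E}
    (hX : X ∈ M.circuits) (hY : Y ∈ M.circuits) {e f : E} (hXe : X e ≠ 0) (hYe : Y e ≠ 0)
    (hXf : X f ≠ 0) (hYf : Y f = 0) :
    ∃ Z ∈ M.circuits, Z e = 0 ∧ Z f ≠ 0 ∧ ∀ g, Z g ≠ 0 → X g ≠ 0 ∨ Y g ≠ 0 := by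
  induction hn : (X.supp ∪ Y.supp).ncard using Nat.strong_induction_on generalizing X Y e f with
  | _ n ih =>
  have lt : ∀ (X' Y' : SignedSet E) (p : E), (X p ≠ 0 ∨ Y p ≠ 0) → X' p = 0 → Y' p = 0 →
      (∀ g, X' g ≠ 0 ∨ Y' g ≠ 0 → X g ≠ 0 ∨ Y g ≠ 0) →
      (X'.supp ∪ Y'.supp).ncard < n := by
    intro X' Y' p hp h1 h2 h3
    rw [← hn]
    refine Set.ncard_lt_ncard ⟨fun g hg => h3 g hg, fun h => ?_⟩ (Set.toFinite _)
    have := h (show p ∈ X.supp ∪ Y.supp from hp)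
    rcases this with h | h
    · exact h h1
    · exact h h2
  obtain ⟨Z, hZ, hZe, hZs⟩ := M.elim_supp hX hY hXe hYe hXf hYf
  by_cases hZf : Z f = 0
  swap
  · exact ⟨Z, hZ, hZe, hZf, hZs⟩
  obtain ⟨p, hpZ, hpX⟩ : ∃ p, Z p ≠ 0 ∧ X p = 0 := by
    by_contra! h
    exact M.supp_eq hZ hX h e hXe hZe
  have hpY : Y p ≠ 0 := by
    rcases hZs p hpZ with h | h
    · exact absurd hpX h
    · exact h
  obtain ⟨W, hW, hWp, hWe, hWs⟩ := ih _
    (lt Y Z f (Or.inl hXf) hYf hZf (by grind)) hY hZ hpY hpZ hYe hZe rfl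
  have hWf : W f = 0 := by
    by_contra h
    grind
  obtain ⟨V, hV, hVe, hVf, hVs⟩ := ih _
    (lt X W p (Or.inr hpY) hpX hWp (by grind)) hX hW hXe hWe hXf hWf rfl
  exact ⟨V, hV, hVe, hVf, by grind⟩

/-- If no circuit meets `D` in exactly one element, then two circuits that both meet `D` in
exactly `{f, g}` have the same relative sign there. -/
theorem sign_unique [Finite E] (M : OrientedMatroid E) {D : Set E}
    (hD : ∀ X ∈ M.circuits, ∀ f ∈ D, X f ≠ 0 → ∃ g ∈ D, g ≠ f ∧ X g ≠ 0)
    {f g : E} (hf : f ∈ D) (hg : g ∈ D) (hfg : f ≠ g) {X Z : SignedSet E}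
    (hX : X ∈ M.circuits) (hZ : Z ∈ M.circuits)
    (hXD : ∀ h ∈ D, X h ≠ 0 → h = f ∨ h = g) (hZD : ∀ h ∈ D, Z h ≠ 0 → h = f ∨ h = g)
    (hXf : X f = 1) (hZf : Z f = 1) : X g = Z g := by
  induction hn : (X.supp ∪ Z.supp).ncard using Nat.strong_induction_on generalizing X Z with
  | _ n ih =>
  by_contra hbad
  have both : ∀ W ∈ M.circuits, (∀ h ∈ D, W h ≠ 0 → h = f ∨ h = g) → (W f = 0 ↔ W g = 0) := by
    intro W hW hWD
    constructor
    · intro h1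
      by_contra h2
      obtain ⟨k, hk, hk1, hk2⟩ := hD W hW g hg h2
      rcases hWD k hk hk2 with rfl | rfl
      · exact hk2 h1
      · exact hk1 rfl
    · intro h1
      by_contra h2
      obtain ⟨k, hk, hk1, hk2⟩ := hD W hW f hf h2
      rcases hWD k hk hk2 with rfl | rfl
      · exact hk1 rfl
      · exact hk2 h1
  have hXg : X g ≠ 0 := fun h => by
    have := (both X hX hXD).2 h; rw [hXf] at this; exact absurd this (by decide)
  have hZg : Z g ≠ 0 := fun h => by
    have := (both Z hZ hZD).2 h; rw [hZf] at this; exact absurd this (by decide)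
  have hopp : X g = -Z g := (eq_or_eq_neg_sign _ _ hXg hZg).resolve_left hbad
  -- circuits inside the union avoiding `f` and `g` contain the symmetric difference
  have big : ∀ X Z : SignedSet E, X ∈ M.circuits → Z ∈ M.circuits →
      (∀ h ∈ D, X h ≠ 0 → h = f ∨ h = g) → (∀ h ∈ D, Z h ≠ 0 → h = f ∨ h = g) →
      X f = 1 → Z f = 1 → X g ≠ Z g → (X.supp ∪ Z.supp).ncard = n →
      ∀ W ∈ M.circuits, W f = 0 → W g = 0 → (∀ h, W h ≠ 0 → X h ≠ 0 ∨ Z h ≠ 0) →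
      ∀ h, X h ≠ 0 → Z h = 0 → W h ≠ 0 := by
    intro X Z hX hZ hXD hZD hXf hZf hbad hn W hW hWf hWg hWs h hXh hZh
    obtain ⟨p, hpW, hpX⟩ : ∃ p, W p ≠ 0 ∧ X p = 0 := by
      by_contra! h
      exact M.supp_eq hW hX h f (by rw [hXf]; decide) hWf
    have hpZ : Z p ≠ 0 := (hWs p hpW).resolve_left (by simpa using hpX)
    obtain ⟨V, hV, hVp, hVf, hVs⟩ := M.strong_supp hZ hW hpZ hpW
      (f := f) (by rw [hZf]; decide) hWf
    obtain ⟨U, hU, hUf, hUV⟩ : ∃ U ∈ M.circuits, U f = 1 ∧ ∀ h, U h = 0 ↔ V h = 0 := by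
      rcases eq_or_eq_neg_sign (V f) 1 hVf (by decide) with h | h
      · exact ⟨V, hV, h, fun _ => Iff.rfl⟩
      · exact ⟨-V, M.neg_mem _ hV, by simp [h], by simp⟩
    have hUD : ∀ h ∈ D, U h ≠ 0 → h = f ∨ h = g := by
      intro h hh hUh
      rcases hVs h (fun h' => hUh ((hUV h).2 h')) with h1 | h1
      · exact hZD h hh h1
      · rcases hWs h h1 with h2 | h2
        · exact hXD h hh h2
        · exact hZD h hh h2
    have e1 : X g = U g := by
      refine ih _ ?_ hX hU hXD hUD hXf hUf rfl
      rw [← hn]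
      refine Set.ncard_lt_ncard ⟨?_, fun h => ?_⟩ (Set.toFinite _)
      · rintro k (hk | hk)
        · exact Or.inl hk
        · rcases hVs k (fun h' => hk ((hUV k).2 h')) with h1 | h1
          · exact Or.inr h1
          · exact hWs k h1
      · rcases h (show p ∈ X.supp ∪ Z.supp from Or.inr hpZ) with h | h
        · exact h hpX
        · exact h ((hUV p).2 hVp)
    by_contra hWh
    have e2 : Z g = U g := by
      refine ih _ ?_ hZ hU hZD hUD hZf hUf rfl
      rw [← hn]
      refine Set.ncard_lt_ncard ⟨?_, fun h' => ?_⟩ (Set.toFinite _)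
      · rintro k (hk | hk)
        · exact Or.inr hk
        · rcases hVs k (fun h' => hk ((hUV k).2 h')) with h1 | h1
          · exact Or.inr h1
          · exact hWs k h1
      · rcases h' (show h ∈ X.supp ∪ Z.supp from Or.inl hXh) with h1 | h1
        · exact h1 hZh
        · rcases hVs h (fun h2 => h1 ((hUV h).2 h2)) with h3 | h3
          · exact h3 hZh
          · exact h3 hWh
    exact hbad (e1.trans e2.symm)
  obtain ⟨z, hzZ, hzX⟩ : ∃ z, Z z ≠ 0 ∧ X z = 0 := by
    by_contra! h
    rcases M.incomparable Z hZ X hX h with rfl | rfl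
    · exact hbad rfl
    · simp [hXf] at hZf
  obtain ⟨x, hxX, hxZ⟩ : ∃ x, X x ≠ 0 ∧ Z x = 0 := by
    by_contra! h
    rcases M.incomparable X hX Z hZ h with rfl | rfl
    · exact hbad rfl
    · simp [hZf] at hXf
  have hn' : (Z.supp ∪ X.supp).ncard = n := by rw [Set.union_comm]; exact hn
  have zeros : ∀ W ∈ M.circuits, (∀ h, W h ≠ 0 → X h ≠ 0 ∨ Z h ≠ 0) → (W f = 0 ∨ W g = 0) →
      W f = 0 ∧ W g = 0 := by
    intro W hW hs h
    have := both W hW (fun k hk hWk => by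
      rcases hs k hWk with h | h
      · exact hXD k hk h
      · exact hZD k hk h)
    tauto
  obtain ⟨W, hW, hWg, hWs⟩ := M.elim hX hZ (by rintro rfl; simp [hxZ] at hxX) hopp hXg
  obtain ⟨W', hW', hWf', hWs'⟩ := M.elim hX (M.neg_mem _ hZ) (e := f)
    (by rw [neg_neg]; rintro rfl; exact hbad rfl) (by simp [hXf, hZf]) (by rw [hXf]; decide)
  have s1 : ∀ h, W h ≠ 0 → X h ≠ 0 ∨ Z h ≠ 0 := by
    intro h hh
    rcases hWs h with h1 | h1 | h1
    · exact absurd h1 hh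
    · left; rwa [← h1]
    · right; rwa [← h1]
  have s2 : ∀ h, W' h ≠ 0 → X h ≠ 0 ∨ Z h ≠ 0 := by
    intro h hh
    rcases hWs' h with h1 | h1 | h1
    · exact absurd h1 hh
    · left; rwa [← h1]
    · right; intro h2; apply hh; rw [h1]; simp [h2]
  obtain ⟨hWf, -⟩ := zeros W hW s1 (Or.inr hWg)
  obtain ⟨-, hWg'⟩ := zeros W' hW' s2 (Or.inl hWf')
  have a1 := big X Z hX hZ hXD hZD hXf hZf hbad hn W hW hWf hWg s1 x hxX hxZ
  have a2 := big X Z hX hZ hXD hZD hXf hZf hbad hn W' hW' hWf' hWg' s2 x hxX hxZ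
  have b1 := big Z X hZ hX hZD hXD hZf hXf (Ne.symm hbad) hn' W hW hWf hWg
    (fun h hh => (s1 h hh).symm) z hzZ hzX
  have b2 := big Z X hZ hX hZD hXD hZf hXf (Ne.symm hbad) hn' W' hW' hWf' hWg'
    (fun h hh => (s2 h hh).symm) z hzZ hzX
  have c1 : W z = -W' z := by
    have h1 := hWs z
    have h2 := hWs' z
    simp only [hzX, Pi.neg_apply] at h1 h2
    have h1 : W z = Z z := by tauto
    have h2 : W' z = -Z z := by tauto
    simp [h1, h2]
  have c2 : W x = W' x := by
    have h1 := hWs x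
    have h2 := hWs' x
    simp only [hxZ, Pi.neg_apply, neg_zero] at h1 h2
    have h1 : W x = X x := by tauto
    have h2 : W' x = X x := by tauto
    simp [h1, h2]
  obtain ⟨U, hU, hUz, hUs⟩ := M.elim hW hW' (fun h => by
    have := congrFun h x
    rw [Pi.neg_apply, c2] at this
    revert this a2
    generalize W' x = t
    revert t
    decide) c1 b1
  have hUs' : ∀ h, U h ≠ 0 → W h ≠ 0 ∨ W' h ≠ 0 := by
    intro h hh
    rcases hUs h with h1 | h1 | h1
    · exact absurd h1 hh
    · left; rwa [← h1]
    · right; rwa [← h1]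
  refine big Z X hZ hX hZD hXD hZf hXf (Ne.symm hbad) hn' U hU ?_ ?_ ?_ z hzZ hzX hUz
  · by_contra h
    rcases hUs' f h with h | h
    · exact h hWf
    · exact h hWf'
  · by_contra h
    rcases hUs' g h with h | h
    · exact h hWg
    · exact h hWg'
  · intro h hh
    rcases hUs' h hh with h | h
    · exact (s1 _ h).symm
    · exact (s2 _ h).symm

theorem not_orth_single {X Y : SignedSet E} {s : E} (hX : X s ≠ 0) (hY : Y s ≠ 0)
    (h : ∀ g, g ≠ s → X g * Y g = 0) : ¬ X.Orth Y := by
  rintro (h1 | ⟨⟨a, ha⟩, ⟨b, hb⟩⟩)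
  · have := h1 s
    revert hX hY this
    generalize X s = u
    generalize Y s = v
    revert u v
    decide
  · have h2 : a = s := by
      by_contra h'
      rw [h a h'] at ha
      exact absurd ha (by decide)
    have h3 : b = s := by
      by_contra h'
      rw [h b h'] at hb
      exact absurd hb (by decide)
    rw [h2] at ha
    rw [h3, ha] at hb
    exact absurd hb (by decide)

/-- The existence of a signed cocircuit with a given support `D`. -/
theorem exists_cocircuit_supp [Finite E] (M : OrientedMatroid E) {D : Set E}
    (hD : ∀ X ∈ M.circuits, ∀ f ∈ D, X f ≠ 0 → ∃ g ∈ D, g ≠ f ∧ X g ≠ 0)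
    {e : E} (he : e ∈ D)
    (hA : ∀ r ∈ D, r ≠ e → ∃ A ∈ M.circuits, A e = 1 ∧ A r ≠ 0 ∧
      ∀ h ∈ D, A h ≠ 0 → h = e ∨ h = r) :
    ∃ Y ∈ M.cocircuits, Y e = 1 ∧ ∀ g, Y g ≠ 0 ↔ g ∈ D := by
  classical
  choose! A hAC hAe hAr hAD using hA
  let Y : SignedSet E := fun h => if h = e then 1 else if h ∈ D then -(A h h) else 0
  have hYe : Y e = 1 := if_pos rfl
  have hYr : ∀ r ∈ D, r ≠ e → Y r = -(A r r) := by
    intro r hr hre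
    simp only [Y, if_neg hre, if_pos hr]
  have hYD : ∀ g, g ∉ D → Y g = 0 := by
    intro g hg
    have : g ≠ e := by rintro rfl; exact hg he
    simp only [Y, if_neg this, if_neg hg]
  have hY0 : ∀ g, Y g ≠ 0 ↔ g ∈ D := by
    intro g
    constructor
    · intro h
      by_contra h'
      exact h (hYD g h')
    · intro h
      by_cases hge : g = e
      · rw [hge, hYe]; decide
      · rw [hYr g h hge]
        have := hAr g h hge
        simpa using this
  have main : ∀ X ∈ M.circuits, (∀ h, X h * Y h ≠ -1) → ∀ h ∈ D, X h = 0 := by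
    intro X hX hXY
    induction hn : {h | h ∈ D ∧ h ≠ e ∧ X h ≠ 0}.ncard using Nat.strong_induction_on
      generalizing X with
    | _ n ih =>
    by_contra! hcon
    obtain ⟨f, hf, hfe, hXf⟩ : ∃ f ∈ D, f ≠ e ∧ X f ≠ 0 := by
      obtain ⟨h, hh, hXh⟩ := hcon
      by_cases hhe : h = e
      · subst hhe
        exact hD X hX h hh hXh
      · exact ⟨h, hh, hhe, hXh⟩
    have hXYf : X f = Y f := by
      have h1 := hXY f
      have h2 := (hY0 f).2 hf
      revert h1 h2 hXf
      generalize X f = u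
      generalize Y f = v
      revert u v
      decide
    have inner : ∀ Z ∈ M.circuits, Z e = 1 → (∀ h ∈ D, Z h ≠ 0 → h = e ∨ h = f) → False := by
      intro Z hZ hZe hZD
      induction hm : (X.supp ∪ Z.supp).ncard using Nat.strong_induction_on generalizing Z with
      | _ m ihm =>
      have hZf : Z f = -Y f := by
        rw [hYr f hf hfe, neg_neg]
        exact M.sign_unique hD he hf (Ne.symm hfe) hZ (hAC f hf hfe) hZD (hAD f hf hfe) hZe
          (hAe f hf hfe)
      obtain ⟨W, hW, hWf, hWs⟩ := M.elim hX hZ (e := f) (by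
        rintro rfl
        apply hXY e
        simp [hZe, hYe]) (by rw [hZf, neg_neg, hXYf]) hXf
      have hWY : ∀ h, W h * Y h ≠ -1 := by
        intro h hh
        have hhD : h ∈ D := by
          rw [← hY0]
          intro h'
          rw [h'] at hh
          simp at hh
        rcases hWs h with h1 | h1 | h1
        · rw [h1] at hh; simp at hh
        · rw [h1] at hh; exact hXY h hh
        · by_cases hhe : h = e
          · rw [h1, hhe, hZe, hYe] at hh; exact absurd hh (by decide)
          · by_cases hhf : h = f
            · rw [hhf, hWf] at hh; simp at hh
            · have : Z h = 0 := by
                by_contra h'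
                rcases hZD h hhD h' with h2 | h2
                · exact hhe h2
                · exact hhf h2
              rw [h1, this] at hh; simp at hh
      have hW0 : ∀ h ∈ D, W h = 0 := by
        refine ih _ ?_ W hW hWY rfl
        rw [← hn]
        refine Set.ncard_lt_ncard ⟨?_, fun h => ?_⟩ (Set.toFinite _)
        · rintro k ⟨hk, hke, hWk⟩
          refine ⟨hk, hke, ?_⟩
          rcases hWs k with h1 | h1 | h1
          · exact absurd h1 hWk
          · rwa [← h1]
          · rcases hZD k hk (by rwa [← h1]) with h2 | h2
            · exact absurd h2 hke
            · rw [h2]; exact hXf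
        · exact (h ⟨hf, hfe, hXf⟩).2.2 hWf
      have hWs' : ∀ h, W h ≠ 0 → X h ≠ 0 ∨ Z h ≠ 0 := by
        intro h hh
        rcases hWs h with h1 | h1 | h1
        · exact absurd h1 hh
        · left; rwa [← h1]
        · right; rwa [← h1]
      obtain ⟨p, hpW, hpX⟩ : ∃ p, W p ≠ 0 ∧ X p = 0 := by
        by_contra! h
        exact M.supp_eq hW hX h f hXf hWf
      have hpZ : Z p ≠ 0 := (hWs' p hpW).resolve_left (by simpa using hpX)
      obtain ⟨V, hV, hVp, hVe, hVs⟩ := M.strong_supp hZ hW hpZ hpW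
        (f := e) (by rw [hZe]; decide) (hW0 e he)
      obtain ⟨U, hU, hUe, hUV⟩ : ∃ U ∈ M.circuits, U e = 1 ∧ ∀ h, U h = 0 ↔ V h = 0 := by
        rcases eq_or_eq_neg_sign (V e) 1 hVe (by decide) with h | h
        · exact ⟨V, hV, h, fun _ => Iff.rfl⟩
        · exact ⟨-V, M.neg_mem _ hV, by simp [h], by simp⟩
      refine ihm _ ?_ U hU hUe ?_ rfl
      · rw [← hm]
        refine Set.ncard_lt_ncard ⟨?_, fun h => ?_⟩ (Set.toFinite _)
        · rintro k (hk | hk)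
          · exact Or.inl hk
          · rcases hVs k (fun h' => hk ((hUV k).2 h')) with h1 | h1
            · exact Or.inr h1
            · exact hWs' k h1
        · rcases h (show p ∈ X.supp ∪ Z.supp from Or.inr hpZ) with h | h
          · exact h hpX
          · exact h ((hUV p).2 hVp)
      · intro h hh hUh
        rcases hVs h (fun h' => hUh ((hUV h).2 h')) with h1 | h1
        · exact hZD h hh h1
        · exact absurd (hW0 h hh) h1
    exact inner (A f) (hAC f hf hfe) (hAe f hf hfe) (hAD f hf hfe)
  have vanish : ∀ X : SignedSet E, (∀ h ∈ D, X h = 0) → ∀ h, X h * Y h = 0 := by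
    intro X hX h
    by_cases hh : h ∈ D
    · rw [hX h hh, zero_mul]
    · rw [hYD h hh, mul_zero]
  refine ⟨Y, ⟨?_, ?_, ?_⟩, hYe, hY0⟩
  · intro h
    have h1 := congrFun h e
    rw [hYe] at h1
    exact absurd h1 (by simp)
  · intro X hX
    by_contra hXY
    by_cases h1 : ∀ h, X h * Y h ≠ -1
    · exact hXY (Or.inl (vanish X (main X hX h1)))
    · by_cases h2 : ∀ h, (-X) h * Y h ≠ -1
      · apply hXY
        left
        refine vanish X fun h hh => ?_
        simpa using main (-X) (M.neg_mem _ hX) h2 h hh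
      · push Not at h1 h2
        obtain ⟨a, ha⟩ := h1
        obtain ⟨b, hb⟩ := h2
        refine hXY (Or.inr ⟨⟨b, ?_⟩, ⟨a, ha⟩⟩)
        simpa using hb
  · intro Y' hY' horth hs
    refine Set.Subset.antisymm hs ?_
    intro r hr
    by_contra hr'
    have hr' : Y' r = 0 := by simpa [SignedSet.supp] using hr'
    have hrD : r ∈ D := (hY0 r).1 hr
    obtain ⟨s, hs'⟩ : ∃ s, Y' s ≠ 0 := by
      by_contra! h
      exact hY' (funext h)
    have hsD : s ∈ D := (hY0 s).1 (hs hs')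
    have hrs : s ≠ r := by rintro rfl; exact hs' hr'
    obtain ⟨Z, hZ, hZs, hZD⟩ : ∃ Z ∈ M.circuits, Z s ≠ 0 ∧
        ∀ h ∈ D, Z h ≠ 0 → h = s ∨ h = r := by
      by_cases hre : r = e
      · subst hre
        exact ⟨A s, hAC s hsD hrs, hAr s hsD hrs, fun h hh h' => (hAD s hsD hrs h hh h').symm⟩
      by_cases hse : s = e
      · subst hse
        exact ⟨A r, hAC r hrD hre, by rw [hAe r hrD hre]; decide,
          fun h hh h' => hAD r hrD hre h hh h'⟩
      obtain ⟨Z, hZ, hZe, hZs, hZ'⟩ := M.strong_supp (hAC s hsD hse) (hAC r hrD hre)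
        (e := e) (f := s) (by rw [hAe s hsD hse]; decide) (by rw [hAe r hrD hre]; decide)
        (hAr s hsD hse) (by
          by_contra h
          rcases hAD r hrD hre s hsD h with h | h
          · exact hse h
          · exact hrs h)
      refine ⟨Z, hZ, hZs, fun h hh h' => ?_⟩
      have hne : h ≠ e := by rintro rfl; exact h' hZe
      rcases hZ' h h' with h1 | h1
      · exact Or.inl ((hAD s hsD hse h hh h1).resolve_left hne)
      · exact Or.inr ((hAD r hrD hre h hh h1).resolve_left hne)
    refine not_orth_single hZs hs' (fun g hg => ?_) (horth Z hZ)
    by_cases h1 : Y' g = 0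
    · rw [h1, mul_zero]
    · by_cases h2 : Z g = 0
      · rw [h2, zero_mul]
      · rcases hZD g ((hY0 g).1 (hs h1)) h2 with h | h
        · exact absurd h hg
        · exact absurd hr' (h ▸ h1)

theorem neg_mem_cocircuits (M : OrientedMatroid E) {Y : SignedSet E} (hY : Y ∈ M.cocircuits) :
    -Y ∈ M.cocircuits := by
  have hs : (-Y).supp = Y.supp := by ext; simp [SignedSet.supp]
  obtain ⟨h1, h2, h3⟩ := hY
  refine ⟨fun h => h1 (funext fun g => by simpa using congrFun h g), fun X hX => ?_, ?_⟩
  · rcases h2 X hX with h | ⟨⟨a, ha⟩, ⟨b, hb⟩⟩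
    · left
      intro e
      have := h e
      simp only [Pi.neg_apply, mul_neg, this, neg_zero]
    · right
      exact ⟨⟨b, by simp [hb]⟩, ⟨a, by simp [ha]⟩⟩
  · rw [hs]
    exact h3

/-- Colour the elements other than `e`: on `G` circuits are free and cocircuits vanish, on `R`
circuits vanish and cocircuits are free, elsewhere both carry the sign prescribed by `s`. -/
theorem painting [Finite E] (M : OrientedMatroid E) (s : SignedSet E) (hs : ∀ g, s g ≠ 0)
    (e : E) (G R : Set E) (hGR : Disjoint G R) (heG : e ∉ G) (heR : e ∉ R) :
    (∃ X ∈ M.circuits, X e = s e ∧ (∀ g ∈ R, X g = 0) ∧ ∀ g ∉ G, X g = 0 ∨ X g = s g) ∨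
    (∃ Y ∈ M.cocircuits, Y e = s e ∧ (∀ g ∈ G, Y g = 0) ∧ ∀ g ∉ R, Y g = 0 ∨ Y g = s g) := by
  classical
  suffices H : ∀ T : Set E, ∀ G R : Set E, Disjoint G R → e ∉ G → e ∉ R →
      (∀ g, g = e ∨ g ∈ G ∨ g ∈ R ∨ g ∈ T) →
      (∃ X ∈ M.circuits, X e = s e ∧ (∀ g ∈ R, X g = 0) ∧ ∀ g ∉ G, X g = 0 ∨ X g = s g) ∨
      (∃ Y ∈ M.cocircuits, Y e = s e ∧ (∀ g ∈ G, Y g = 0) ∧ ∀ g ∉ R, Y g = 0 ∨ Y g = s g) from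
    H Set.univ G R hGR heG heR (by simp)
  clear hGR heG heR G R
  intro T
  induction T, Set.toFinite T using Set.Finite.induction_on with
  | empty =>
    intro G R hGR heG heR hall
    by_cases hno : ∃ X ∈ M.circuits, X e ≠ 0 ∧ ∀ g, X g ≠ 0 → g = e ∨ g ∈ G
    · left
      obtain ⟨X, hX, hXe, hXG⟩ := hno
      obtain ⟨U, hU, hUe, hUX⟩ : ∃ U ∈ M.circuits, U e = s e ∧ ∀ h, U h = 0 ↔ X h = 0 := by
        rcases eq_or_eq_neg_sign (X e) (s e) hXe (hs e) with h | h
        · exact ⟨X, hX, h, fun _ => Iff.rfl⟩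
        · exact ⟨-X, M.neg_mem _ hX, by simp [h], by simp⟩
      refine ⟨U, hU, hUe, fun g hg => ?_, fun g hg => ?_⟩
      · by_contra h
        rcases hXG g (fun h' => h ((hUX g).2 h')) with h1 | h1
        · exact heR (h1 ▸ hg)
        · exact Set.disjoint_left.1 hGR h1 hg
      · by_cases h : U g = 0
        · exact Or.inl h
        · rcases hXG g (fun h' => h ((hUX g).2 h')) with h1 | h1
          · right; rw [h1, hUe]
          · exact absurd h1 hg
    · right
      let P : Set E → Prop := fun H => e ∉ H ∧ ¬ ∃ X ∈ M.circuits, X e ≠ 0 ∧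
        ∀ g, X g ≠ 0 → g = e ∨ g ∈ H
      obtain ⟨H, hGH, hH⟩ := Finite.exists_le_maximal (p := P) (a := G) ⟨heG, hno⟩
      have hHn : ∀ X ∈ M.circuits, X e ≠ 0 → ∃ g, X g ≠ 0 ∧ g ≠ e ∧ g ∉ H := by
        intro X hX hXe
        by_contra! h
        exact hH.prop.2 ⟨X, hX, hXe, fun g hg => by
          by_cases h' : g = e
          · exact Or.inl h'
          · exact Or.inr (h g hg h')⟩
      have hA : ∀ r ∈ Hᶜ, r ≠ e → ∃ A ∈ M.circuits, A e = 1 ∧ A r ≠ 0 ∧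
          ∀ h ∈ Hᶜ, A h ≠ 0 → h = e ∨ h = r := by
        intro r hr hre
        have hne : ¬ P (insert r H) := fun h =>
          hr (hH.le_of_ge h (Set.subset_insert r H) (Set.mem_insert r H))
        have : ∃ X ∈ M.circuits, X e ≠ 0 ∧ ∀ g, X g ≠ 0 → g = e ∨ g ∈ insert r H := by
          by_contra h
          refine hne ⟨?_, h⟩
          rintro (h1 | h1)
          · exact hre h1.symm
          · exact hH.prop.1 h1
        obtain ⟨X, hX, hXe, hXs⟩ := this
        have hXr : X r ≠ 0 := by
          intro h
          obtain ⟨g, h1, h2, h3⟩ := hHn X hX hXe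
          rcases hXs g h1 with h4 | h4 | h4
          · exact h2 h4
          · exact h1 (h4 ▸ h)
          · exact h3 h4
        have hXD : ∀ h ∈ Hᶜ, X h ≠ 0 → h = e ∨ h = r := by
          intro h hh h'
          rcases hXs h h' with h4 | h4 | h4
          · exact Or.inl h4
          · exact Or.inr h4
          · exact absurd h4 hh
        rcases eq_or_eq_neg_sign (X e) 1 hXe (by decide) with h | h
        · exact ⟨X, hX, h, hXr, hXD⟩
        · exact ⟨-X, M.neg_mem _ hX, by simp [h], by simpa using hXr,
            fun k hk hk' => hXD k hk (by simpa using hk')⟩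
      have hD : ∀ X ∈ M.circuits, ∀ f ∈ Hᶜ, X f ≠ 0 → ∃ g ∈ Hᶜ, g ≠ f ∧ X g ≠ 0 := by
        intro X hX f hf hXf
        by_contra! hc
        by_cases hfe : f = e
        · subst hfe
          obtain ⟨g, h1, h2, h3⟩ := hHn X hX hXf
          exact h1 (hc g h3 h2)
        · obtain ⟨A, hAC, hAe, hAf, hAD⟩ := hA f hf hfe
          have hXe : X e = 0 := hc e hH.prop.1 (Ne.symm hfe)
          obtain ⟨Z, hZ, hZf, hZe, hZs⟩ := M.strong_supp hAC hX (e := f) (f := e) hAf hXf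
            (by rw [hAe]; decide) hXe
          obtain ⟨g, h1, h2, h3⟩ := hHn Z hZ hZe
          have hgf : g ≠ f := by rintro rfl; exact h1 hZf
          rcases hZs g h1 with h4 | h4
          · rcases hAD g h3 h4 with h5 | h5
            · exact h2 h5
            · exact hgf h5
          · exact h4 (hc g h3 hgf)
      obtain ⟨Y, hY, hYe, hYD⟩ := M.exists_cocircuit_supp hD (e := e) hH.prop.1 hA
      obtain ⟨U, hU, hUe, hUY⟩ : ∃ U ∈ M.cocircuits, U e = s e ∧ ∀ h, U h = 0 ↔ Y h = 0 := by
        rcases eq_or_eq_neg_sign (s e) 1 (hs e) (by decide) with h | h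
        · exact ⟨Y, hY, by rw [hYe, h], fun _ => Iff.rfl⟩
        · exact ⟨-Y, M.neg_mem_cocircuits hY, by simp [h, hYe], by simp⟩
      have hUG : ∀ g ∈ G, U g = 0 := by
        intro g hg
        rw [hUY]
        by_contra h
        exact (hYD g).1 h (hGH hg)
      refine ⟨U, hU, hUe, hUG, fun g hg => ?_⟩
      rcases hall g with h | h | h | h
      · right; rw [h, hUe]
      · exact Or.inl (hUG g h)
      · exact absurd h hg
      · exact absurd h (by simp)
  | @insert a T _ _ ih =>
    intro G R hGR heG heR hall
    by_cases ha : a = e ∨ a ∈ G ∨ a ∈ R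
    · refine ih G R hGR heG heR fun g => ?_
      rcases hall g with h | h | h | h | h
      · tauto
      · tauto
      · tauto
      · rw [h]; tauto
      · tauto
    · push Not at ha
      obtain ⟨hae, haG, haR⟩ := ha
      rcases ih (insert a G) R (by simp [haR, hGR]) (by simp [Ne.symm hae, heG]) heR
        (fun g => by have := hall g; simp only [Set.mem_insert_iff] at this ⊢; tauto) with
        ⟨X, hX, hXe, hXR, hXs⟩ | ⟨Y, hY, hYe, hYG, hYs⟩
      swap
      · exact Or.inr ⟨Y, hY, hYe, fun g hg => hYG g (Or.inr hg), hYs⟩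
      by_cases hXa : X a = 0 ∨ X a = s a
      · left
        refine ⟨X, hX, hXe, hXR, fun g hg => ?_⟩
        by_cases hga : g = a
        · rw [hga]; exact hXa
        · exact hXs g (by simp [hga, hg])
      rcases ih G (insert a R) (by simp [haG, hGR]) heG (by simp [Ne.symm hae, heR])
        (fun g => by have := hall g; simp only [Set.mem_insert_iff] at this ⊢; tauto) with
        ⟨X', hX', hX'e, hX'R, hX's⟩ | ⟨Y, hY, hYe, hYG, hYs⟩
      · exact Or.inl ⟨X', hX', hX'e, fun g hg => hX'R g (Or.inr hg), hX's⟩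
      by_cases hYa : Y a = 0 ∨ Y a = s a
      · right
        refine ⟨Y, hY, hYe, hYG, fun g hg => ?_⟩
        by_cases hga : g = a
        · rw [hga]; exact hYa
        · exact hYs g (by simp [hga, hg])
      exfalso
      push Not at hXa hYa
      have hXa' := (eq_or_eq_neg_sign _ _ hXa.1 (hs a)).resolve_left hXa.2
      have hYa' := (eq_or_eq_neg_sign _ _ hYa.1 (hs a)).resolve_left hYa.2
      have sq : ∀ t : SignType, t * t ≠ -1 := by decide
      rcases hY.2.1 X hX with h | ⟨-, ⟨b, hb⟩⟩
      · have h1 := h e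
        have h2 := hs e
        rw [hXe, hYe] at h1
        revert h1 h2
        generalize s e = t
        revert t
        decide
      · by_cases hba : b = a
        · rw [hba, hXa', hYa', neg_mul_neg] at hb
          exact sq _ hb
        · by_cases hbG : b ∈ G
          · rw [hYG b hbG, mul_zero] at hb
            exact absurd hb (by decide)
          · by_cases hbR : b ∈ R
            · rw [hXR b hbR, zero_mul] at hb
              exact absurd hb (by decide)
            · rcases hXs b (by simp [hba, hbG]) with h1 | h1
              · rw [h1, zero_mul] at hb
                exact absurd hb (by decide)
              · rcases hYs b (by simp [hba, hbR]) with h2 | h2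
                · rw [h2, mul_zero] at hb
                  exact absurd hb (by decide)
                · rw [h1, h2] at hb
                  exact sq _ hb

/-- Elimination for cocircuits, keeping an element `h` on which the signs are not opposite. -/
theorem cocircuits_elim [Finite E] (M : OrientedMatroid E) {Y Y' : SignedSet E}
    (hY : Y ∈ M.cocircuits) (hY' : Y' ∈ M.cocircuits) {e h : E} (he : Y e = 1)
    (he' : Y' e = -1) (hh : Y h ≠ 0) (hh' : Y' h ≠ -Y h) :
    ∃ Z ∈ M.cocircuits, Z e = 0 ∧ Z h = Y h ∧ ∀ g, Z g = 0 ∨ Z g = Y g ∨ Z g = Y' g := by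
  classical
  have hhe : h ≠ e := by
    rintro rfl
    apply hh'
    rw [he, he']
  let s : SignedSet E := fun g => if Y g ≠ 0 then Y g else if Y' g ≠ 0 then Y' g else 1
  have hs : ∀ g, s g ≠ 0 := by
    intro g
    simp only [s]
    split_ifs with h1 h2
    · exact h1
    · exact h2
    · decide
  let R : Set E := {g | g ≠ e ∧ Y g ≠ 0 ∧ Y' g = -Y g}
  let G : Set E := {g | g = e ∨ (Y g = 0 ∧ Y' g = 0)}
  have hsh : s h = Y h := if_pos hh
  rcases M.painting s hs h G R
    (by rw [Set.disjoint_left]; rintro g (h1 | h1) ⟨h2, h3, -⟩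
        · exact h2 h1
        · exact h3 h1.1)
    (by rintro (h1 | h1)
        · exact hhe h1
        · exact hh h1.1)
    (by rintro ⟨-, -, h1⟩; exact hh' h1) with ⟨X, hX, hXh, hXR, hXs⟩ | ⟨Z, hZ, hZh, hZG, hZs⟩
  · exfalso
    rw [hsh] at hXh
    have sgn : ∀ g, g ≠ e → X g * Y g ≠ -1 ∧ X g * Y' g ≠ -1 := by
      intro g hge
      by_cases hgR : g ∈ R
      · rw [hXR g hgR]; simp
      · by_cases hgG : g ∈ G
        · rcases hgG with h1 | ⟨h1, h2⟩
          · exact absurd h1 hge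
          · rw [h1, h2]; simp
        · have h1 := hXs g hgG
          have h2 : ¬ (Y g ≠ 0 ∧ Y' g = -Y g) := fun h => hgR ⟨hge, h⟩
          simp only [s] at h1
          revert h1 h2
          generalize X g = a
          generalize Y g = b
          generalize Y' g = c
          revert a b c
          decide
    have hXY : X h * Y h = 1 := by
      rw [hXh]
      revert hh
      generalize Y h = a
      revert a
      decide
    by_cases hXe : X e = -1
    · -- positive at `e` against `Y'`
      have n1 : ∀ g, X g * Y' g ≠ -1 := by
        intro g
        by_cases hge : g = e
        · rw [hge, hXe, he']; decide
        · exact (sgn g hge).2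
      rcases hY'.2.1 X hX with h1 | ⟨-, ⟨b, hb⟩⟩
      · have := h1 e
        rw [hXe, he'] at this
        exact absurd this (by decide)
      · exact n1 b hb
    · have n1 : ∀ g, X g * Y g ≠ -1 := by
        intro g
        by_cases hge : g = e
        · rw [hge, he, mul_one]; exact hXe
        · exact (sgn g hge).1
      rcases hY.2.1 X hX with h1 | ⟨-, ⟨b, hb⟩⟩
      · rw [h1 h] at hXY
        exact absurd hXY (by decide)
      · exact n1 b hb
  · refine ⟨Z, hZ, hZG e (Or.inl rfl), by rw [hZh, hsh], fun g => ?_⟩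
    by_cases hge : g = e
    · left; rw [hge]; exact hZG e (Or.inl rfl)
    · by_cases hg0 : Y g = 0 ∧ Y' g = 0
      · exact Or.inl (hZG g (Or.inr hg0))
      · by_cases hgR : g ∈ R
        · obtain ⟨-, h1, h2⟩ := hgR
          revert h1 h2
          generalize Z g = a
          generalize Y g = b
          generalize Y' g = c
          revert a b c
          decide
        · have h1 := hZs g hgR
          simp only [s] at h1
          revert h1 hg0
          generalize Z g = a
          generalize Y g = b
          generalize Y' g = c
          revert a b c
          decide

/-- The dual oriented matroid: its circuits are the cocircuits of `M`. -/
def dual [Finite E] (M : OrientedMatroid E) : OrientedMatroid E where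
  circuits := M.cocircuits
  zero_notMem := fun h => h.1 rfl
  neg_mem := fun _ hY => M.neg_mem_cocircuits hY
  incomparable := by
    intro Y hY Y' hY' hs
    have hs' : Y.supp = Y'.supp := hY'.2.2 Y hY.1 hY.2.1 hs
    have hz : ∀ g, Y g = 0 ↔ Y' g = 0 := by
      intro g
      have := Set.ext_iff.1 hs' g
      simp only [SignedSet.supp, Set.mem_ofPred_eq] at this
      tauto
    by_contra! hne
    obtain ⟨e, he⟩ : ∃ e, Y e ≠ Y' e := Function.ne_iff.1 hne.1
    obtain ⟨h, hh⟩ : ∃ h, Y h ≠ (-Y') h := Function.ne_iff.1 hne.2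
    have he0 : Y e ≠ 0 := fun h' => he (h'.trans ((hz e).1 h').symm)
    have he0' : Y' e ≠ 0 := fun h' => he0 ((hz e).2 h')
    have hh0 : Y h ≠ 0 := fun h' => hh (by simp [h', (hz h).1 h'])
    have hh1 : Y' h ≠ -Y h := by
      intro h'
      apply hh
      simp [h']
    have key : ∃ Z ∈ M.cocircuits, Z e = 0 ∧ ∀ g, Z g = 0 ∨ Z g = Y g ∨ Z g = Y' g := by
      have hcase : (Y e = 1 ∧ Y' e = -1) ∨ (Y e = -1 ∧ Y' e = 1) := by
        revert he he0 he0'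
        generalize Y e = a
        generalize Y' e = b
        revert a b
        decide
      rcases hcase with ⟨h1, h2⟩ | ⟨h1, h2⟩
      · obtain ⟨Z, hZ, hZe, -, hZs⟩ := M.cocircuits_elim hY hY' h1 h2 hh0 hh1
        exact ⟨Z, hZ, hZe, hZs⟩
      · obtain ⟨Z, hZ, hZe, -, hZs⟩ := M.cocircuits_elim hY' hY h2 h1
          (fun h' => hh0 ((hz h).2 h')) (by simpa using hh)
        exact ⟨Z, hZ, hZe, fun g => by have := hZs g; tauto⟩
    obtain ⟨Z, hZ, hZe, hZs⟩ := key
    have : Z.supp = Y.supp := hY.2.2 Z hZ.1 hZ.2.1 (by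
      intro g hg
      rcases hZs g with h1 | h1 | h1
      · exact absurd h1 hg
      · intro h2; exact hg (h1.trans h2)
      · intro h2; exact hg (h1.trans ((hz g).1 h2)))
    have h1 : e ∈ Z.supp := by rw [this]; exact he0
    exact h1 hZe
  elimination := by
    intro Y hY Y' hY' hne e he he'
    have hex : ∃ h, Y h ≠ 0 ∧ Y' h ≠ -Y h := by
      by_contra! hc
      have hs : Y.supp = Y'.supp := hY'.2.2 Y hY.1 hY.2.1 (by
        intro g hg h
        have h1 := hc g hg
        rw [h] at h1
        exact hg (by simpa using h1.symm))
      apply hne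
      funext g
      by_cases hg : Y g = 0
      · have h1 : g ∉ Y'.supp := by rw [← hs]; exact fun h => h hg
        have h2 : Y' g = 0 := by simpa [SignedSet.supp] using h1
        simp [hg, h2]
      · simp [hc g hg]
    obtain ⟨h, hh, hh'⟩ := hex
    obtain ⟨Z, hZ, hZe, -, hZs⟩ := M.cocircuits_elim hY hY' he he' hh hh'
    refine ⟨Z, hZ, fun g hg => ⟨?_, ?_⟩, fun g hg => ⟨?_, ?_⟩⟩
    · have hg : Z g = 1 := hg
      rcases hZs g with h1 | h1 | h1
      · rw [h1] at hg; exact absurd hg (by decide)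
      · exact Or.inl (h1.symm.trans hg)
      · exact Or.inr (h1.symm.trans hg)
    · rintro rfl
      have hg : Z g = 1 := hg
      rw [hZe] at hg; exact absurd hg (by decide)
    · have hg : Z g = -1 := hg
      rcases hZs g with h1 | h1 | h1
      · rw [h1] at hg; exact absurd hg (by decide)
      · exact Or.inl (h1.symm.trans hg)
      · exact Or.inr (h1.symm.trans hg)
    · rintro rfl
      have hg : Z g = -1 := hg
      rw [hZe] at hg; exact absurd hg (by decide)

/-- The oriented matroid obtained from `M` by reorienting the element `f`. -/
noncomputable def reorient (M : OrientedMatroid E) (f : E) : OrientedMatroid E where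
  circuits := {X | ∃ X' ∈ M.circuits, X = X'.reorient f}
  zero_notMem := by
    rintro ⟨X, hX, h⟩
    have : X = 0 := by
      funext g
      have := congrFun h g
      simp only [SignedSet.reorient, Pi.zero_apply] at this
      split_ifs at this
      · simpa using this.symm
      · simpa using this.symm
    exact M.zero_notMem (this ▸ hX)
  neg_mem := by
    rintro _ ⟨X, hX, rfl⟩
    refine ⟨-X, M.neg_mem X hX, ?_⟩
    funext g
    simp only [SignedSet.reorient, Pi.neg_apply]
    split_ifs
    · rfl
    · rfl
  incomparable := by
    rintro _ ⟨X, hX, rfl⟩ _ ⟨Y, hY, rfl⟩ h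
    have hs : ∀ Z : SignedSet E, (Z.reorient f).supp = Z.supp := by
      intro Z
      ext g
      simp only [SignedSet.supp, SignedSet.reorient, Set.mem_ofPred_eq]
      split_ifs
      · simp
      · rfl
    rw [hs, hs] at h
    rcases M.incomparable X hX Y hY h with rfl | rfl
    · exact Or.inl rfl
    · right
      funext g
      simp only [SignedSet.reorient, Pi.neg_apply]
      split_ifs
      · rfl
      · rfl
  elimination := by
    rintro _ ⟨X, hX, rfl⟩ _ ⟨Y, hY, rfl⟩ hne e he he'
    have he : (X.reorient f) e = 1 := he
    have he' : (Y.reorient f) e = -1 := he'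
    have h1 : X ≠ -Y := by
      rintro rfl
      apply hne
      funext g
      simp only [SignedSet.reorient, Pi.neg_apply]
      split_ifs
      · rfl
      · rfl
    have h2 : X e = -Y e ∧ X e ≠ 0 := by
      simp only [SignedSet.reorient] at he he'
      revert he he'
      generalize X e = a
      generalize Y e = b
      split_ifs
      · revert a b; decide
      · revert a b; decide
    obtain ⟨Z, hZ, hZe, hZs⟩ := M.elim hX hY h1 h2.1 h2.2
    have hs : ∀ g, Z.reorient f g = 0 ∨ Z.reorient f g = X.reorient f g ∨
        Z.reorient f g = Y.reorient f g := by
      intro g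
      have := hZs g
      simp only [SignedSet.reorient]
      split_ifs
      · simpa using this
      · exact this
    have hZe' : Z.reorient f e = 0 := by
      simp only [SignedSet.reorient, hZe]
      simp
    refine ⟨_, ⟨Z, hZ, rfl⟩, fun g hg => ⟨?_, ?_⟩, fun g hg => ⟨?_, ?_⟩⟩
    · have hg : Z.reorient f g = 1 := hg
      rcases hs g with h1 | h1 | h1
      · rw [h1] at hg; exact absurd hg (by decide)
      · exact Or.inl (h1.symm.trans hg)
      · exact Or.inr (h1.symm.trans hg)
    · rintro rfl
      have hg : Z.reorient f g = 1 := hg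
      rw [hZe'] at hg; exact absurd hg (by decide)
    · have hg : Z.reorient f g = -1 := hg
      rcases hs g with h1 | h1 | h1
      · rw [h1] at hg; exact absurd hg (by decide)
      · exact Or.inl (h1.symm.trans hg)
      · exact Or.inr (h1.symm.trans hg)
    · rintro rfl
      have hg : Z.reorient f g = -1 := hg
      rw [hZe'] at hg; exact absurd hg (by decide)

end OrientedMatroid

/-!
The theorem is a translation of the signed painting lemma `OrientedMatroid.painting` together with
the biduality `M.dual.dual = M`.

Since the circuits of `M` are the cocircuits of `M.dual`, and reorientation commutes with taking
cocircuits, the generators of the right hand side are the complements of the vertex sets of the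
circuits `X` of `M` with `X f = -1` (`mem_cocircuits_dual_reorient`). So the claim is that, for a
set `σ` of vertices, exactly one of the following holds: some cocircuit `C` with `C f = 1` has its
vertex set disjoint from `σ`, or some circuit `X` with `X f = -1` has its vertex set inside `σ`.

* At most one holds (`not_disjoint_vertexSet`): a circuit and a cocircuit that are opposite at `f`
  are orthogonal, hence agree at some other element, and so share a vertex.
* At least one holds (`exists_cocircuit_or_circuit`): colour `i ≠ f` according to which of
  `x_i`, `y_i` belong to `σ`. Both in `σ` means that `X` is free at `i` and `C` vanishes there,
  neither means the reverse, and exactly one prescribes the signs of `-X` and `C` at `i`, to the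
  same value. This is the situation of the painting lemma.

Biduality itself is another use of the painting lemma (`exists_circuit_conformal`): a signed set
orthogonal to all cocircuits contains, through each element of its support, a circuit that conforms
to it.
-/

namespace SignedSet

variable {E : Type*}

theorem Orth.symm {X Y : SignedSet E} (h : X.Orth Y) : Y.Orth X := by
  simpa only [Orth, mul_comm] using h

theorem reorient_self (f : E) (X : SignedSet E) : X.reorient f f = -X f := if_pos rfl

theorem reorient_of_ne {f g : E} (h : g ≠ f) (X : SignedSet E) : X.reorient f g = X g := if_neg h

theorem reorient_reorient (f : E) (X : SignedSet E) : (X.reorient f).reorient f = X := by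
  funext g
  by_cases h : g = f
  · subst h; simp only [reorient_self, neg_neg]
  · simp only [reorient_of_ne h]

theorem reorient_eq_zero_iff (f : E) (X : SignedSet E) (g : E) : X.reorient f g = 0 ↔ X g = 0 := by
  by_cases h : g = f
  · subst h; simp [reorient_self]
  · rw [reorient_of_ne h]

theorem supp_reorient (f : E) (X : SignedSet E) : (X.reorient f).supp = X.supp := by
  ext g
  exact not_congr (reorient_eq_zero_iff f X g)

theorem reorient_ne_zero {f : E} {X : SignedSet E} (h : X ≠ 0) : X.reorient f ≠ 0 := by
  obtain ⟨g, hg⟩ := Function.ne_iff.1 h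
  exact Function.ne_iff.2 ⟨g, fun h' => hg ((reorient_eq_zero_iff f X g).1 h')⟩

theorem reorient_mul (f : E) (X Y : SignedSet E) (g : E) :
    X.reorient f g * Y g = X g * Y.reorient f g := by
  by_cases h : g = f
  · subst h; simp [reorient_self]
  · simp only [reorient_of_ne h]

theorem orth_reorient (f : E) (X Y : SignedSet E) :
    (X.reorient f).Orth Y ↔ X.Orth (Y.reorient f) := by
  simp only [Orth, reorient_mul]

end SignedSet

namespace OrientedMatroid

variable {E : Type*}

/-! ### Biduality -/

/-- A signed set `X` orthogonal to all cocircuits contains a conforming circuit through each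
element of its support. -/
theorem exists_circuit_conformal [Finite E] (M : OrientedMatroid E) {X : SignedSet E}
    (hX : ∀ C ∈ M.cocircuits, C.Orth X) {e : E} (he : X e ≠ 0) :
    ∃ Z ∈ M.circuits, Z e = X e ∧ ∀ g, Z g = 0 ∨ Z g = X g := by
  classical
  let s : SignedSet E := fun g => if X g = 0 then 1 else X g
  have hs : ∀ g, s g ≠ 0 := by
    intro g
    simp only [s]
    split_ifs with h
    · decide
    · exact h
  have hsX : ∀ g, X g ≠ 0 → s g = X g := fun g hg => if_neg hg
  rcases M.painting s hs e ∅ {g | X g = 0} (Set.empty_disjoint _) (Set.notMem_empty _) he with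
    ⟨Z, hZ, hZe, hZR, hZs⟩ | ⟨C, hC, hCe, -, hCs⟩
  · refine ⟨Z, hZ, hZe.trans (hsX e he), fun g => ?_⟩
    by_cases hg : X g = 0
    · exact Or.inl (hZR g hg)
    · simpa only [hsX g hg] using hZs g (Set.notMem_empty _)
  · -- `C` conforms to `X` on the support of `X` and is nonzero at `e`, against orthogonality.
    exfalso
    rw [hsX e he] at hCe
    rcases hX C hC with h | ⟨-, g, hg⟩
    · have := h e
      rw [hCe] at this
      revert this he
      generalize X e = a
      revert a
      decide
    · by_cases hg0 : X g = 0
      · rw [hg0, mul_zero] at hg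
        exact absurd hg (by decide)
      · have h1 := hCs g hg0
        rw [hsX g hg0] at h1
        revert h1 hg
        generalize X g = a
        generalize C g = b
        revert a b
        decide

theorem cocircuits_dual [Finite E] (M : OrientedMatroid E) : M.dual.cocircuits = M.circuits := by
  have orth : ∀ X ∈ M.circuits, ∀ C ∈ M.cocircuits, C.Orth X := fun X hX C hC => (hC.2.1 X hX).symm
  ext X
  constructor
  · rintro ⟨hX0, hX, hmin⟩
    obtain ⟨e, he⟩ := Function.ne_iff.1 hX0
    obtain ⟨Z, hZ, hZe, hZX⟩ := M.exists_circuit_conformal hX he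
    have hs : Z.supp = X.supp := by
      refine hmin Z (fun h => M.zero_notMem (h ▸ hZ)) (orth Z hZ) fun g hg => ?_
      rcases hZX g with h | h
      · exact absurd h hg
      · exact fun h' => hg (h.trans h')
    have : Z = X := by
      funext g
      rcases hZX g with h | h
      · by_contra h'
        have hg : g ∈ X.supp := fun h0 => h' (h.trans h0.symm)
        rw [← hs] at hg
        exact hg h
      · exact h
    exact this ▸ hZ
  · intro hX
    refine ⟨fun h => M.zero_notMem (h ▸ hX), orth X hX, fun Y hY0 hY hYX => ?_⟩
    obtain ⟨e, he⟩ := Function.ne_iff.1 hY0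
    obtain ⟨Z, hZ, -, hZY⟩ := M.exists_circuit_conformal hY he
    have hZY' : Z.supp ⊆ Y.supp := fun g hg => by
      rcases hZY g with h | h
      · exact absurd h hg
      · exact fun h' => hg (h.trans h')
    exact hYX.antisymm fun g hg =>
      hZY' (M.supp_eq hZ hX (fun g hg => hYX (hZY' hg)) g hg)

theorem mem_cocircuits_reorient (M : OrientedMatroid E) (f : E) (Y : SignedSet E) :
    Y ∈ (M.reorient f).cocircuits ↔ Y.reorient f ∈ M.cocircuits := by
  have orth : ∀ Z : SignedSet E, (∀ X ∈ (M.reorient f).circuits, X.Orth Z) ↔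
      ∀ X ∈ M.circuits, X.Orth (Z.reorient f) := by
    intro Z
    constructor
    · exact fun h X hX => (SignedSet.orth_reorient f X Z).1 (h _ ⟨X, hX, rfl⟩)
    · rintro h _ ⟨X, hX, rfl⟩
      exact (SignedSet.orth_reorient f X Z).2 (h X hX)
  constructor
  · rintro ⟨h0, h1, h2⟩
    refine ⟨SignedSet.reorient_ne_zero h0, (orth Y).1 h1, fun Z hZ0 hZ hZs => ?_⟩
    rw [SignedSet.supp_reorient] at hZs ⊢
    rw [← SignedSet.supp_reorient f Z] at hZs ⊢
    refine h2 _ (SignedSet.reorient_ne_zero hZ0) ((orth _).2 ?_) hZs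
    rwa [SignedSet.reorient_reorient]
  · rintro ⟨h0, h1, h2⟩
    have h0' := SignedSet.reorient_ne_zero (f := f) h0
    rw [SignedSet.reorient_reorient] at h0'
    refine ⟨h0', (orth Y).2 h1, fun Z hZ0 hZ hZs => ?_⟩
    have := h2 _ (SignedSet.reorient_ne_zero (f := f) hZ0) ((orth Z).1 hZ)
    simp only [SignedSet.supp_reorient] at this
    exact this hZs

/-- The cocircuits of the reoriented dual are the reoriented circuits. -/
theorem mem_cocircuits_dual_reorient [Finite E] (M : OrientedMatroid E) (f : E)
    (Y : SignedSet E) :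
    Y ∈ (M.dual.reorient f).cocircuits ↔ Y.reorient f ∈ M.circuits := by
  rw [mem_cocircuits_reorient, cocircuits_dual]

/-! ### Vertex sets of signed sets -/

theorem inl_mem_vertexSet {f : E} {C : SignedSet E} {i : {i : E // i ≠ f}} :
    (Sum.inl i : Vertex f) ∈ vertexSet f C ↔ C i = 1 := by
  simp [vertexSet, SignedSet.pos, -Subtype.exists]

theorem inr_mem_vertexSet {f : E} {C : SignedSet E} {i : {i : E // i ≠ f}} :
    (Sum.inr i : Vertex f) ∈ vertexSet f C ↔ C i = -1 := by
  simp [vertexSet, SignedSet.neg, -Subtype.exists]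

theorem vertexSet_reorient (f : E) (C : SignedSet E) :
    vertexSet f (C.reorient f) = vertexSet f C := by
  ext (i | i)
  · rw [inl_mem_vertexSet, inl_mem_vertexSet, SignedSet.reorient_of_ne i.2]
  · rw [inr_mem_vertexSet, inr_mem_vertexSet, SignedSet.reorient_of_ne i.2]

/-- Orthogonal signed sets that are opposite at `f` share a vertex. -/
theorem not_disjoint_vertexSet {f : E} {X C : SignedSet E} (h : X.Orth C) (hX : X f = -1)
    (hC : C f = 1) : ¬ Disjoint (vertexSet f X) (vertexSet f C) := by
  rw [Set.not_disjoint_iff]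
  rcases h with h | ⟨⟨g, hg⟩, -⟩
  · have := h f
    rw [hX, hC] at this
    exact absurd this (by decide)
  · have hgf : g ≠ f := by
      rintro rfl
      rw [hX, hC] at hg
      exact absurd hg (by decide)
    have hsign : (X g = 1 ∧ C g = 1) ∨ (X g = -1 ∧ C g = -1) := by
      revert hg
      generalize X g = a
      generalize C g = b
      revert a b
      decide
    rcases hsign with ⟨h1, h2⟩ | ⟨h1, h2⟩
    · exact ⟨Sum.inl ⟨g, hgf⟩, inl_mem_vertexSet.2 h1, inl_mem_vertexSet.2 h2⟩
    · exact ⟨Sum.inr ⟨g, hgf⟩, inr_mem_vertexSet.2 h1, inr_mem_vertexSet.2 h2⟩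

/-- The painting lemma in terms of vertex sets. -/
theorem exists_cocircuit_or_circuit [Finite E] (M : OrientedMatroid E) (f : E)
    (σ : Set (Vertex f)) :
    (∃ C ∈ M.cocircuits, C f = 1 ∧ vertexSet f C ⊆ σᶜ) ∨
      ∃ X ∈ M.circuits, X f = -1 ∧ vertexSet f X ⊆ σ := by
  classical
  let x : Set E := {g | ∃ h : g ≠ f, Sum.inl ⟨g, h⟩ ∈ σ}
  let y : Set E := {g | ∃ h : g ≠ f, Sum.inr ⟨g, h⟩ ∈ σ}
  have hfx : f ∉ x := fun h => h.1 rfl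
  have hfy : f ∉ y := fun h => h.1 rfl
  have hx : ∀ i : {i : E // i ≠ f}, Sum.inl i ∈ σ ↔ i.1 ∈ x := fun i =>
    ⟨fun h => ⟨i.2, h⟩, fun h => h.2⟩
  have hy : ∀ i : {i : E // i ≠ f}, Sum.inr i ∈ σ ↔ i.1 ∈ y := fun i =>
    ⟨fun h => ⟨i.2, h⟩, fun h => h.2⟩
  -- The value of `s` on `x ∩ y`, and off `x ∪ y` except at `f`, is irrelevant.
  let s : SignedSet E := fun g => if g ∈ x then -1 else 1
  have hsx : ∀ g ∈ x, s g = -1 := fun g hg => if_pos hg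
  have hsx' : ∀ g ∉ x, s g = 1 := fun g hg => if_neg hg
  have hs : ∀ g, s g ≠ 0 := by
    intro g
    simp only [s]
    split_ifs
    · decide
    · decide
  rcases M.painting s hs f {g | g ∈ x ∧ g ∈ y} {g | g ≠ f ∧ g ∉ x ∧ g ∉ y}
    (Set.disjoint_left.2 fun g h h' => h'.2.1 h.1) (fun h => hfx h.1) (fun h => h.1 rfl) with
    ⟨X, hX, hXf, hXR, hXs⟩ | ⟨C, hC, hCf, hCG, hCs⟩
  · -- Painting gives `X` the sign of `C` at `f`; it is `-X` that is opposite to `C` there.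
    right
    refine ⟨-X, M.neg_mem X hX, by rw [Pi.neg_apply, hXf, hsx' f hfx], ?_⟩
    rintro (i | i) hi
    · rw [inl_mem_vertexSet, Pi.neg_apply, neg_eq_iff_eq_neg] at hi
      by_contra hσ
      rw [hx] at hσ
      by_cases hiy : i.1 ∈ y
      · have := hXs i fun h => hσ h.1
        rw [hsx' i hσ, hi] at this
        exact absurd this (by decide)
      · have := hXR i ⟨i.2, hσ, hiy⟩
        rw [hi] at this
        exact absurd this (by decide)
    · rw [inr_mem_vertexSet, Pi.neg_apply, neg_inj] at hi
      by_contra hσ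
      rw [hy] at hσ
      by_cases hix : i.1 ∈ x
      · have := hXs i fun h => hσ h.2
        rw [hsx i hix, hi] at this
        exact absurd this (by decide)
      · have := hXR i ⟨i.2, hix, hσ⟩
        rw [hi] at this
        exact absurd this (by decide)
  · left
    refine ⟨C, hC, hCf.trans (hsx' f hfx), ?_⟩
    rintro (i | i) hi hσ
    · rw [inl_mem_vertexSet] at hi
      rw [hx] at hσ
      have := hCs i fun h => h.2.1 hσ
      rw [hsx i hσ, hi] at this
      exact absurd this (by decide)
    · rw [inr_mem_vertexSet] at hi
      rw [hy] at hσ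
      by_cases hix : i.1 ∈ x
      · have := hCG i ⟨hix, hσ⟩
        rw [hi] at this
        exact absurd this (by decide)
      · have := hCs i fun h => h.2.2 hσ
        rw [hsx' i hix, hi] at this
        exact absurd this (by decide)

end OrientedMatroid

theorem theorem1 {E : Type*} [Finite E] (M : OrientedMatroid E) (f : E) :
    (M.affineComplex f).alexanderDual = (M.dual.reorient f).affineComplex f := by
  ext τ
  constructor
  · rintro ⟨σ, hσ, rfl⟩
    rcases M.exists_cocircuit_or_circuit f σ with ⟨C, hC, hCf, hCσ⟩ | ⟨X, hX, hXf, hXσ⟩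
    · exact absurd ⟨C, hC, hCf, Set.subset_compl_comm.1 hCσ⟩ hσ
    · refine ⟨X.reorient f, ?_, ?_, ?_⟩
      · rwa [M.mem_cocircuits_dual_reorient, SignedSet.reorient_reorient]
      · change X.reorient f f = 1
        rw [SignedSet.reorient_self, hXf, neg_neg]
      · rwa [OrientedMatroid.vertexSet_reorient, Set.compl_subset_compl]
  · rintro ⟨Y, hY, hYf, hτ⟩
    rw [M.mem_cocircuits_dual_reorient] at hY
    refine ⟨τᶜ, ?_, (compl_compl τ).symm⟩
    rintro ⟨C, hC, hCf, hCτ⟩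
    have hYf' : Y.reorient f f = -1 := by
      rw [SignedSet.reorient_self, show Y f = 1 from hYf]
    refine OrientedMatroid.not_disjoint_vertexSet (hC.2.1 _ hY) hYf' hCf ?_
    rw [OrientedMatroid.vertexSet_reorient]
    exact Set.disjoint_left.2 fun v hvY hvC => hCτ (fun hv => hτ hv hvY) hvC
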